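/- **Setting.** A Lipschitz language $L$ is a first order language in which every function symbol $F$ and every relation symbol $R$ carries a Lipschitz constant $\lambda_F,\lambda_R\ge 0$, and in which equality is replaced by a metric symbol $d$. An $L$-structure is a nonempty complete metric space $(M,d)$ with $d\le 1$, together with a $\lambda_F$-Lipschitz map $F^M:M^n\to M$ for each $n$-ary function symbol $F$ (constants being $0$-ary) and a $\lambda_R$-Lipschitz map $R^M:M^n\to[0,1]$ for each $n$-ary relation symbol $R$, where $M^n$ has the metric $\sum_i d(x_i,y_i)$. Affine formulas are built from $1$, $R(t_1,\dots,t_n)$ and $d(t_1,t_2)$ ($t_i$ terms) by $r\cdot\phi$ ($r\in\mathbb R$), $\phi+\psi$, $\inf_x\phi$, $\sup_x\phi$, and are interpreted as real-valued functions in the usual way. A condition is an expression $\phi\le\psi$. For $A\subseteq M$, a partial $n$-type over $A$ is a set of conditions in $n$ variables with parameters from $A$ that is satisfied by a tuple in some model of the complete affine theory of $(M,a)_{a\in A}$; an $n$-type over $A$ is a maximal partial $n$-type. A type $p$ contains, for each formula $\phi$, the condition $\phi=r$ for exactly one real $r=:p(\phi)$, and is identified with the functional $\phi\mapsto p(\phi)$.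 The set $S_n(A)$ of $n$-types over $A$ is a convex set of functionals; a type is extreme if it is an extreme point of $S_n(A)$. A type $p$ is realized in $M$ if there is $\bar b\in M^n$ with $\phi^M(\bar b)=p(\phi)$ for all $\phi$. For a cardinal $\kappa$, $M$ is extremally $\kappa$-saturated if for every $A\subseteq M$ with $|A|<\kappa$ and every $n$, every extreme type in $S_n(A)$ is realized in $M$. An ultrafilter $\mathcal F$ on a set $I$ is countably incomplete if it is not closed under countable intersections. It is $\kappa$-good if for every infinite cardinal $\lambda<\kappa$ and every $f:S_\omega(\lambda)\to\mathcal F$ ($S_\omega(\lambda)$ the set of finite subsets of $\lambda$) with $f(\tau)\supseteq f(\eta)$ whenever $\tau\subseteq\eta$, there is $g:S_\omega(\lambda)\to\mathcal F$ with $g(\tau\cup\eta)=g(\tau)\cap g(\eta)$ and $g(\tau)\subseteq f(\tau)$ for all $\tau,\eta$. The ultraproduct $\prod_{\mathcal F}M_i$ is the quotient of $\prod_i M_i$ by the pseudometric $\lim_{\mathcal F}d(a_i,b_i)$, with $F([a_i])=[F^{M_i}(a_i)]$ and $R([a_i])=\lim_{\mathcal F}R^{M_i}(a_i)$; it is again an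 $L$-structure. **Proposition.** Let $L$ be a Lipschitz language, $\kappa$ an infinite cardinal with $|L|+\aleph_0<\kappa$ (where $|L|$ is the number of function and relation symbols of $L$), $\mathcal F$ a countably incomplete $\kappa$-good ultrafilter on a set $I$, and $M_i$ an $L$-structure for each $i\in I$. Then $\prod_{\mathcal F}M_i$ is extremally $\kappa$-saturated. -/

import Mathlib

open Filter Topology Cardinal
open scoped NNReal

universe u

namespace AffineLogic

/-- A Lipschitz language: a first order language with a Lipschitz constant for every function and
every relation symbol (constant symbols are the function symbols of arity `0`). The metric symbol is
a logical symbol and is not listed among the relation symbols. -/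
structure LipschitzLanguage extends FirstOrder.Language.{u, u} where
  funLip : ∀ {n : ℕ}, Functions n → ℝ≥0
  relLip : ∀ {n : ℕ}, Relations n → ℝ≥0

/-- An `L`-structure: a nonempty complete metric space of diameter at most `1`, with Lipschitz
interpretations of the symbols, where `Mⁿ` has the metric `∑ i, d (x i) (y i)` and relations take
values in `[0, 1]`. -/
structure MetricStructure (L : LipschitzLanguage.{u}) where
  carrier : Type u
  [metric : MetricSpace carrier]
  [nonempty : Nonempty carrier]
  [complete : CompleteSpace carrier]
  dist_le_one : ∀ x y : carrier, dist x y ≤ 1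
  funMap : ∀ {n : ℕ}, L.Functions n → (Fin n → carrier) → carrier
  relMap : ∀ {n : ℕ}, L.Relations n → (Fin n → carrier) → ℝ
  funMap_lipschitz : ∀ {n : ℕ} (f : L.Functions n) (x y : Fin n → carrier),
    dist (funMap f x) (funMap f y) ≤ L.funLip f * ∑ i, dist (x i) (y i)
  relMap_mem : ∀ {n : ℕ} (R : L.Relations n) (x : Fin n → carrier),
    relMap R x ∈ Set.Icc (0 : ℝ) 1
  relMap_lipschitz : ∀ {n : ℕ} (R : L.Relations n) (x y : Fin n → carrier),
    |relMap R x - relMap R y| ≤ L.relLip R * ∑ i, dist (x i) (y i)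

instance (L : LipschitzLanguage.{u}) : CoeSort (MetricStructure L) (Type u) :=
  ⟨MetricStructure.carrier⟩

instance {L : LipschitzLanguage.{u}} (M : MetricStructure L) : MetricSpace M := M.metric

instance {L : LipschitzLanguage.{u}} (M : MetricStructure L) : Nonempty M := M.nonempty

instance {L : LipschitzLanguage.{u}} (M : MetricStructure L) : CompleteSpace M := M.complete

/-- Affine formulas with free variables in `α` and `n` further variables `0, …, n - 1`, of which the
last one is bound by a quantifier. -/
inductive BoundedFormula (L : LipschitzLanguage.{u}) (α : Type u) : ℕ → Type u
  | one {n : ℕ} : BoundedFormula L α n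
  | rel {n l : ℕ} (R : L.Relations l) (ts : Fin l → L.toLanguage.Term (α ⊕ Fin n)) :
      BoundedFormula L α n
  | metric {n : ℕ} (t₁ t₂ : L.toLanguage.Term (α ⊕ Fin n)) : BoundedFormula L α n
  | smul {n : ℕ} (r : ℝ) (φ : BoundedFormula L α n) : BoundedFormula L α n
  | add {n : ℕ} (φ ψ : BoundedFormula L α n) : BoundedFormula L α n
  | inf {n : ℕ} (φ : BoundedFormula L α (n + 1)) : BoundedFormula L α n
  | sup {n : ℕ} (φ : BoundedFormula L α (n + 1)) : BoundedFormula L α n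

/-- Affine formulas with free variables in `α`. -/
abbrev Formula (L : LipschitzLanguage.{u}) (α : Type u) : Type u := BoundedFormula L α 0

section Semantics

variable {L : LipschitzLanguage.{u}} (M : MetricStructure L)

/-- The value in `M` of a term. -/
def termValue {β : Type u} (v : β → M) : L.toLanguage.Term β → M
  | .var b => v b
  | .func f ts => M.funMap f fun i => termValue v (ts i)

/-- The value in `M` of a formula. -/
noncomputable def evalBounded {α : Type u} (v : α → M) :
    ∀ {n : ℕ}, BoundedFormula L α n → (Fin n → M) → ℝ
  | _, .one, _ => 1
  | _, .rel R ts, x => M.relMap R fun i => termValue M (Sum.elim v x) (ts i)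
  | _, .metric t₁ t₂, x => dist (termValue M (Sum.elim v x) t₁) (termValue M (Sum.elim v x) t₂)
  | _, .smul r φ, x => r * evalBounded v φ x
  | _, .add φ ψ, x => evalBounded v φ x + evalBounded v ψ x
  | _, .inf φ, x => ⨅ y : M, evalBounded v φ (Fin.snoc x y)
  | _, .sup φ, x => ⨆ y : M, evalBounded v φ (Fin.snoc x y)

/-- The value in `M` of the formula `φ` at the assignment `v` of its free variables. -/
noncomputable def eval {α : Type u} (v : α → M) (φ : Formula L α) : ℝ :=
  evalBounded M v φ Fin.elim0

end Semantics

section Types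

variable {L : LipschitzLanguage.{u}} (M : MetricStructure L) (A : Set M) (n : ℕ)

/-- Formulas in `n` variables with parameters in `A`: a variable indexed by `a : A` plays the role of
a constant symbol for `a`. -/
abbrev ParamFormula : Type u := Formula L (A ⊕ Fin n)

/-- A condition `φ ≤ ψ` in `n` variables over `A`. -/
abbrev Condition : Type u := ParamFormula M A n × ParamFormula M A n

/-- `(N, c)` is a model of the complete theory of `(M, a)_{a ∈ A}`. -/
def IsModelOver (N : MetricStructure L) (c : A → N) : Prop :=
  ∀ σ : Formula L A, eval N c σ = eval M (fun a : A => (a : M)) σ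

/-- A partial `n`-type over `A`: a set of conditions satisfied by some tuple in some model of the
theory of `(M, a)_{a ∈ A}`. -/
def IsPartialType (Γ : Set (Condition M A n)) : Prop :=
  ∃ (N : MetricStructure L) (c : A → N) (b : Fin n → N), IsModelOver M A N c ∧
    ∀ q ∈ Γ, eval N (Sum.elim c b) q.1 ≤ eval N (Sum.elim c b) q.2

/-- An `n`-type over `A`: a maximal partial `n`-type. -/
def IsType (Γ : Set (Condition M A n)) : Prop := Maximal (IsPartialType M A n) Γ

/-- The space `S_n(A)` of `n`-types over `A`, where a type `Γ` is identified with the functional `p`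
for which `φ = p φ` belongs to `Γ` for every `φ` (that is, `φ ≤ p φ · 1` and `p φ · 1 ≤ φ` do). -/
def typeSpace : Set (ParamFormula M A n → ℝ) :=
  {p | ∃ Γ : Set (Condition M A n), IsType M A n Γ ∧
    ∀ φ, (φ, .smul (p φ) .one) ∈ Γ ∧ (.smul (p φ) .one, φ) ∈ Γ}

/-- The type `p` over `A` is realized in `M`. -/
def IsRealized {M : MetricStructure L} {A : Set M} {n : ℕ} (p : ParamFormula M A n → ℝ) : Prop :=
  ∃ b : Fin n → M, ∀ φ, eval M (Sum.elim (fun a : A => (a : M)) b) φ = p φ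

/-- `M` is extremally `κ`-saturated: every extreme type over fewer than `κ` parameters is realized
in `M`. -/
def IsExtremallySaturated (κ : Cardinal.{u}) : Prop :=
  ∀ A : Set M, #A < κ → ∀ n : ℕ, ∀ p ∈ (typeSpace M A n).extremePoints ℝ, IsRealized p

end Types

section Ultrafilters

variable {I : Type u} (F : Ultrafilter I)

/-- `F` is countably incomplete: it is not closed under countable intersections. -/
def IsCountablyIncomplete : Prop := ¬ CountableInterFilter (F : Filter I)

open Classical in
/-- `F` is `κ`-good: for every infinite `lam < κ`, every monotonic function from the finite subsets
of `lam` to `F` is refined by an additive one. -/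
def IsGood (κ : Cardinal.{u}) : Prop :=
  ∀ lam : Type u, ℵ₀ ≤ #lam → #lam < κ → ∀ f : Finset lam → Set I, (∀ s, f s ∈ F) →
    (∀ s t, s ⊆ t → f t ⊆ f s) →
    ∃ g : Finset lam → Set I, (∀ s, g s ∈ F) ∧
      (∀ s t, g (s ∪ t) = g s ∩ g t) ∧ ∀ s, g s ⊆ f s

/-- The limit of `f` along the ultrafilter `F`; it exists if `f` is bounded. -/
noncomputable def ultralimit (f : I → ℝ) : ℝ := limUnder (F : Filter I) f

theorem tendsto_ultralimit {f : I → ℝ} {a b : ℝ} (h : ∀ i, f i ∈ Set.Icc a b) :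
    Tendsto f F (𝓝 (ultralimit F f)) := by
  obtain ⟨x, -, hx⟩ := (isCompact_Icc (a := a) (b := b)).ultrafilter_le_nhds (F.map f)
    (by rw [le_principal_iff]; exact Filter.mem_map.2 (Filter.univ_mem' h))
  exact tendsto_nhds_limUnder ⟨x, hx⟩

end Ultrafilters

section Ultraproduct

variable {L : LipschitzLanguage.{u}} {I : Type u} (F : Ultrafilter I) (M : I → MetricStructure L)

/-- The product of the `M i`, to be given the pseudometric `lim_F d (a i) (b i)`. -/
def PreUltraproduct (_F : Ultrafilter I) (M : I → MetricStructure L) : Type u := ∀ i, M i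

theorem tendsto_dist (a b : ∀ i, M i) :
    Tendsto (fun i => dist (a i) (b i)) F (𝓝 (ultralimit F fun i => dist (a i) (b i))) :=
  tendsto_ultralimit F fun i => ⟨dist_nonneg, (M i).dist_le_one _ _⟩

theorem tendsto_relMap {n : ℕ} (R : L.Relations n) (a : Fin n → ∀ i, M i) :
    Tendsto (fun i => (M i).relMap R fun k => a k i) F
      (𝓝 (ultralimit F fun i => (M i).relMap R fun k => a k i)) :=
  tendsto_ultralimit F fun i => (M i).relMap_mem R _

noncomputable instance : PseudoMetricSpace (PreUltraproduct F M) where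
  dist a b := ultralimit F fun i => dist (a i) (b i)
  dist_self a := tendsto_nhds_unique (tendsto_dist F M a a) (by simp)
  dist_comm a b := by simp only [dist_comm]
  dist_triangle a b c := le_of_tendsto_of_tendsto' (tendsto_dist F M a c)
    ((tendsto_dist F M a b).add (tendsto_dist F M b c)) fun i => dist_triangle _ _ _

/-- The set of classes of elements of the product modulo `lim_F d (a i) (b i) = 0`. -/
abbrev UltraproductCarrier : Type u := SeparationQuotient (PreUltraproduct F M)

/-- The class `[a i]`. -/
noncomputable def ultraMk (a : ∀ i, M i) : UltraproductCarrier F M :=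
  SeparationQuotient.mk (X := PreUltraproduct F M) a

/-- A representative of a class. -/
noncomputable def ultraOut (x : UltraproductCarrier F M) : ∀ i, M i :=
  Quotient.out (s := inseparableSetoid (PreUltraproduct F M)) x

theorem ultraMk_out (x : UltraproductCarrier F M) : ultraMk F M (ultraOut F M x) = x :=
  Quotient.out_eq (s := inseparableSetoid (PreUltraproduct F M)) x

theorem dist_ultraMk (a b : ∀ i, M i) :
    dist (ultraMk F M a) (ultraMk F M b) = ultralimit F fun i => dist (a i) (b i) :=
  SeparationQuotient.dist_mk (α := PreUltraproduct F M) a b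

theorem tendsto_dist_mk (a b : ∀ i, M i) :
    Tendsto (fun i => dist (a i) (b i)) F (𝓝 (dist (ultraMk F M a) (ultraMk F M b))) := by
  rw [dist_ultraMk]; exact tendsto_dist F M a b

theorem tendsto_dist_out (x y : UltraproductCarrier F M) :
    Tendsto (fun i => dist (ultraOut F M x i) (ultraOut F M y i)) F (𝓝 (dist x y)) := by
  simpa only [ultraMk_out] using tendsto_dist_mk F M (ultraOut F M x) (ultraOut F M y)

instance : Nonempty (UltraproductCarrier F M) :=
  ⟨ultraMk F M fun _ => Classical.arbitrary _⟩

/-- An ultraproduct of complete metric spaces is complete, so no completion is needed. -/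
instance : CompleteSpace (UltraproductCarrier F M) := by
  classical
  refine Metric.complete_of_convergent_controlled_sequences (fun n => (1 / 2 : ℝ) ^ n)
    (fun n => by positivity) fun u hu => ?_
  let a : ℕ → ∀ i, M i := fun n => ultraOut F M (u n)
  let P : ℕ → I → Prop := fun n i => ∀ k < n, dist (a k i) (a (k + 1) i) < (1 / 2 : ℝ) ^ k
  have hP : ∀ n, ∀ᶠ i in (F : Filter I), P n i := by
    intro n
    have : ∀ᶠ i in (F : Filter I), ∀ k ∈ Finset.range n,
        dist (a k i) (a (k + 1) i) < (1 / 2 : ℝ) ^ k := by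
      rw [Filter.eventually_all_finset]
      intro k _
      exact (tendsto_dist_out F M (u k) (u (k + 1))).eventually_lt_const
        (hu k k (k + 1) le_rfl (Nat.le_succ k))
    filter_upwards [this] with i hi k hk using hi k (Finset.mem_range.2 hk)
  -- along an initial segment on which consecutive distances are small, distances add up
  have key : ∀ i n m, n ≤ m → P m i →
      dist (a n i) (a m i) ≤ 2 * (1 / 2 : ℝ) ^ n - 2 * (1 / 2 : ℝ) ^ m := by
    intro i n m hnm
    induction m, hnm using Nat.le_induction with
    | base => intro _; simp
    | succ m hnm ih =>
      intro h
      have h1 := ih fun k hk => h k (hk.trans (Nat.lt_succ_self m))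
      have h2 := h m (Nat.lt_succ_self m)
      have h3 := dist_triangle (a n i) (a m i) (a (m + 1) i)
      rw [pow_succ]; linarith
  have hb : ∀ i, ∃ b : M i, ∀ n, P n i → dist (a n i) b ≤ 2 * (1 / 2 : ℝ) ^ n := by
    intro i
    by_cases hi : ∀ n, P n i
    · have hc : CauchySeq fun n => a n i := by
        refine cauchySeq_of_le_geometric (1 / 2) 1 (by norm_num) fun n => ?_
        simpa using (hi (n + 1) n (Nat.lt_succ_self n)).le
      obtain ⟨b, hb⟩ := cauchySeq_tendsto_of_complete hc
      refine ⟨b, fun n _ => le_of_tendsto (tendsto_const_nhds.dist hb) ?_⟩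
      filter_upwards [eventually_ge_atTop n] with m hm
      have h1 := key i n m hm (hi m)
      have h2 : (0 : ℝ) < (1 / 2) ^ m := by positivity
      linarith
    · push Not at hi
      obtain ⟨m, hm, hmin⟩ : ∃ m, ¬ P m i ∧ ∀ k < m, P k i :=
        ⟨Nat.find hi, Nat.find_spec hi, fun k hk => not_not.1 (Nat.find_min hi hk)⟩
      have hm0 : m ≠ 0 := by
        rintro rfl
        exact hm fun k hk => absurd hk (Nat.not_lt_zero k)
      refine ⟨a (m - 1) i, fun n hn => ?_⟩
      have hnm : n < m := by
        by_contra h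
        exact hm fun k hk => hn k (by omega)
      have h1 := key i n (m - 1) (by omega) (hmin _ (by omega))
      have h2 : (0 : ℝ) < (1 / 2) ^ (m - 1) := by positivity
      linarith
  choose b hb using hb
  refine ⟨ultraMk F M b, ?_⟩
  rw [tendsto_iff_dist_tendsto_zero]
  refine squeeze_zero (fun _ => dist_nonneg) (g := fun n => 2 * (1 / 2 : ℝ) ^ n) (fun n => ?_) ?_
  · have h := tendsto_dist_mk F M (a n) b
    rw [show ultraMk F M (a n) = u n from ultraMk_out F M (u n)] at h
    exact le_of_tendsto h ((hP n).mono fun i hi => hb i n hi)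
  · simpa using (tendsto_pow_atTop_nhds_zero_of_lt_one (r := (1 / 2 : ℝ)) (by norm_num)
      (by norm_num)).const_mul 2

/-- The ultraproduct of the `M i` along `F`. -/
noncomputable def ultraproduct : MetricStructure L where
  carrier := UltraproductCarrier F M
  dist_le_one x y := le_of_tendsto' (tendsto_dist_out F M x y) fun i => (M i).dist_le_one _ _
  funMap f x := ultraMk F M fun i => (M i).funMap f fun k => ultraOut F M (x k) i
  relMap R x := ultralimit F fun i => (M i).relMap R fun k => ultraOut F M (x k) i
  funMap_lipschitz f x y := le_of_tendsto_of_tendsto' (tendsto_dist_mk F M _ _)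
    ((tendsto_finsetSum _ fun k _ => tendsto_dist_out F M (x k) (y k)).const_mul _)
    fun i => (M i).funMap_lipschitz f _ _
  relMap_mem R _ := ⟨ge_of_tendsto' (tendsto_relMap F M R _) fun i => ((M i).relMap_mem R _).1,
    le_of_tendsto' (tendsto_relMap F M R _) fun i => ((M i).relMap_mem R _).2⟩
  relMap_lipschitz R x y := le_of_tendsto_of_tendsto'
    ((tendsto_relMap F M R _).sub (tendsto_relMap F M R _)).abs
    ((tendsto_finsetSum _ fun k _ => tendsto_dist_out F M (x k) (y k)).const_mul _)
    fun i => (M i).relMap_lipschitz R _ _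

theorem tendsto_dist_out_mk (a : ∀ i, M i) :
    Tendsto (fun i => dist (ultraOut F M (ultraMk F M a) i) (a i)) F (𝓝 0) := by
  have h := tendsto_dist_mk F M (ultraOut F M (ultraMk F M a)) a
  rwa [ultraMk_out, dist_self] at h

/-- The interpretation of a function symbol does not depend on the representatives. -/
theorem ultraproduct_funMap_mk {n : ℕ} (f : L.Functions n) (a : Fin n → ∀ i, M i) :
    (ultraproduct F M).funMap f (fun k => ultraMk F M (a k)) =
      ultraMk F M fun i => (M i).funMap f fun k => a k i := by
  refine dist_le_zero.1 (le_of_tendsto_of_tendsto' (tendsto_dist_mk F M _ _) ?_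
    fun i => (M i).funMap_lipschitz f _ _)
  simpa using (tendsto_finsetSum Finset.univ fun k _ =>
    tendsto_dist_out_mk F M (a k)).const_mul (L.funLip f : ℝ)

/-- The interpretation of a relation symbol does not depend on the representatives. -/
theorem ultraproduct_relMap_mk {n : ℕ} (R : L.Relations n) (a : Fin n → ∀ i, M i) :
    (ultraproduct F M).relMap R (fun k => ultraMk F M (a k)) =
      ultralimit F fun i => (M i).relMap R fun k => a k i := by
  refine sub_eq_zero.1 (abs_eq_zero.1 (le_antisymm ?_ (abs_nonneg _)))
  refine le_of_tendsto_of_tendsto'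
    ((tendsto_relMap F M R _).sub (tendsto_relMap F M R _)).abs ?_
    fun i => (M i).relMap_lipschitz R _ _
  simpa using (tendsto_finsetSum Finset.univ fun k _ =>
    tendsto_dist_out_mk F M (a k)).const_mul (L.relLip R : ℝ)

end Ultraproduct

end AffineLogic

/-!
An extreme type over a structure `M` is finitely approximable in `M`, and if `M` is an ultraproduct,
a good ultrafilter turns finite approximability into realizability.

*Extreme types are finitely approximable.* Identified with functionals, the types over `A` are the
evaluation functionals of tuples in models of the theory of `(M, a)_{a ∈ A}` (`mem_typeSpace_iff`).
They form a convex set, because the affine theory of a weighted mean of two structures is the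
weighted mean of the two theories (`evalBounded_mean`), and a compact one, because of Łoś's theorem
for affine formulas (`tendsto_evalBounded`, `isCompact_typeSpace`). The supremum of a formula over
all tuples is expressed by the theory, so by the Hahn–Banach theorem every type lies in the closed
convex hull of the types realized in `M` (`typeSpace_subset_closedConvexHull`). Milman's theorem
(`extremePoints_subset_closure_of_subset_closedConvexHull`) then puts the extreme types into the
closure of the realized ones, for the topology of pointwise convergence on formulas.

*Realization in the ultraproduct.* There may be `κ` or more formulas, since all real numbers are
allowed as coefficients, but those with rational coefficients are uniformly dense and fewer than `κ`
in number (`exists_code_approx`, `mk_code_lt`). For these the requirements that a formula be within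
`1 / (k + 1)` of its prescribed value are, by Łoś's theorem, finitely satisfiable in almost all
factors. Countable incompleteness and goodness of the ultrafilter provide one element of the product
which meets each of them in almost all factors (`exists_forall_eventually_of_isGood`), and its class
realizes the type.
-/

namespace AffineLogic

/-! ### Suprema and infima of bounded real functions -/

theorem iInf_eq_neg_iSup_neg {ι : Type*} (f : ι → ℝ) : ⨅ y, f y = -⨆ y, -f y := by
  rw [iInf, Real.sInf_def, iSup, ← Set.image_neg_eq_neg, ← Set.range_comp]
  rfl

theorem bddAbove_range_of_abs_le {ι : Type*} {f : ι → ℝ} {C : ℝ} (h : ∀ y, |f y| ≤ C) :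
    BddAbove (Set.range f) :=
  ⟨C, by rintro _ ⟨y, rfl⟩; exact (abs_le.1 (h y)).2⟩

theorem abs_iSup_le_of_abs_le {ι : Type*} [Nonempty ι] {f : ι → ℝ} {C : ℝ}
    (h : ∀ y, |f y| ≤ C) : |⨆ y, f y| ≤ C := by
  obtain ⟨y⟩ := ‹Nonempty ι›
  exact abs_le.2 ⟨(abs_le.1 (h y)).1.trans (le_ciSup (bddAbove_range_of_abs_le h) y),
    ciSup_le fun y => (abs_le.1 (h y)).2⟩

theorem abs_iInf_le_of_abs_le {ι : Type*} [Nonempty ι] {f : ι → ℝ} {C : ℝ}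
    (h : ∀ y, |f y| ≤ C) : |⨅ y, f y| ≤ C := by
  rw [iInf_eq_neg_iSup_neg, abs_neg]
  exact abs_iSup_le_of_abs_le fun y => by rw [abs_neg]; exact h y

theorem abs_iSup_sub_iSup_le {ι : Type*} [Nonempty ι] {f g : ι → ℝ} {C ε : ℝ}
    (hf : ∀ y, |f y| ≤ C) (h : ∀ y, |f y - g y| ≤ ε) : |(⨆ y, f y) - ⨆ y, g y| ≤ ε := by
  have hg : BddAbove (Set.range g) := bddAbove_range_of_abs_le (C := C + ε) fun y => by
    have h1 := abs_le.1 (hf y)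
    have h2 := abs_le.1 (h y)
    exact abs_le.2 ⟨by linarith, by linarith⟩
  have h1 : ⨆ y, f y ≤ (⨆ y, g y) + ε := ciSup_le fun y => by
    have h2 := abs_le.1 (h y)
    have h3 := le_ciSup hg y
    linarith
  have h4 : ⨆ y, g y ≤ (⨆ y, f y) + ε := ciSup_le fun y => by
    have h2 := abs_le.1 (h y)
    have h3 := le_ciSup (bddAbove_range_of_abs_le hf) y
    linarith
  exact abs_le.2 ⟨by linarith, by linarith⟩

theorem abs_iInf_sub_iInf_le {ι : Type*} [Nonempty ι] {f g : ι → ℝ} {C ε : ℝ}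
    (hf : ∀ y, |f y| ≤ C) (h : ∀ y, |f y - g y| ≤ ε) : |(⨅ y, f y) - ⨅ y, g y| ≤ ε := by
  have h1 := abs_iSup_sub_iSup_le (f := fun y => -f y) (g := fun y => -g y) (C := C) (ε := ε)
    (fun y => by rw [abs_neg]; exact hf y)
    (fun y => by rw [← neg_sub', abs_neg]; exact h y)
  rw [iInf_eq_neg_iSup_neg f, iInf_eq_neg_iSup_neg g, ← neg_sub', abs_neg]
  exact h1

/-! ### Uniform bounds for affine formulas -/

variable {L : LipschitzLanguage.{u}}

theorem abs_relMap_le_one (M : MetricStructure L) {l : ℕ} (R : L.Relations l) (x : Fin l → M) :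
    |M.relMap R x| ≤ 1 :=
  abs_le.2 ⟨by linarith [(M.relMap_mem R x).1], (M.relMap_mem R x).2⟩

theorem abs_dist_le_one (M : MetricStructure L) (x y : M) : |dist x y| ≤ 1 := by
  rw [abs_of_nonneg dist_nonneg]
  exact M.dist_le_one x y

/-- A formula is bounded by a constant that works in all structures at once. -/
theorem exists_bound {α : Type u} {n : ℕ} (φ : BoundedFormula L α n) :
    ∃ C : ℝ, ∀ (M : MetricStructure L) (v : α → M) (x : Fin n → M),
      |evalBounded M v φ x| ≤ C := by
  induction φ with
  | one => exact ⟨1, fun M v x => by simp [evalBounded]⟩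
  | rel R ts => exact ⟨1, fun M v x => abs_relMap_le_one M R _⟩
  | metric t₁ t₂ => exact ⟨1, fun M v x => abs_dist_le_one M _ _⟩
  | smul r φ ih =>
    obtain ⟨C, hC⟩ := ih
    refine ⟨|r| * C, fun M v x => ?_⟩
    rw [evalBounded, abs_mul]
    exact mul_le_mul_of_nonneg_left (hC M v x) (abs_nonneg r)
  | add φ ψ ihφ ihψ =>
    obtain ⟨C, hC⟩ := ihφ
    obtain ⟨D, hD⟩ := ihψ
    exact ⟨C + D, fun M v x => (abs_add_le _ _).trans (add_le_add (hC M v x) (hD M v x))⟩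
  | inf φ ih =>
    obtain ⟨C, hC⟩ := ih
    exact ⟨C, fun M v x => abs_iInf_le_of_abs_le fun y => hC M v _⟩
  | sup φ ih =>
    obtain ⟨C, hC⟩ := ih
    exact ⟨C, fun M v x => abs_iSup_le_of_abs_le fun y => hC M v _⟩

/-! ### Łoś's theorem for affine formulas -/

section Los

variable {I : Type u} (F : Ultrafilter I) (M : I → MetricStructure L)

theorem termValue_ultraproduct {β : Type u} (v : β → ∀ i, M i) (t : L.toLanguage.Term β) :
    termValue (ultraproduct F M) (fun b => ultraMk F M (v b)) t =
      ultraMk F M fun i => termValue (M i) (fun b => v b i) t := by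
  induction t with
  | var b => rfl
  | func f ts ih =>
    simp only [termValue]
    rw [funext ih]
    exact ultraproduct_funMap_mk F M f _

/-- Suprema commute with limits along `F`: near-optimal points may be chosen in each coordinate
separately. -/
theorem tendsto_iSup_ultraproduct {f : ∀ i, M i → ℝ} {g : ultraproduct F M → ℝ} {C : ℝ}
    (hf : ∀ i y, |f i y| ≤ C)
    (h : ∀ y : ∀ i, M i, Tendsto (fun i => f i (y i)) F (𝓝 (g (ultraMk F M y)))) :
    Tendsto (fun i => ⨆ y, f i y) F (𝓝 (⨆ y, g y)) := by
  have hg : ∀ y, |g y| ≤ C := fun y => by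
    obtain ⟨y, rfl⟩ : ∃ z, ultraMk F M z = y := ⟨_, ultraMk_out F M y⟩
    exact le_of_tendsto' (h y).abs fun i => hf i (y i)
  refine tendsto_order.2 ⟨fun c hc => ?_, fun c hc => ?_⟩
  · obtain ⟨y, hy⟩ := exists_lt_of_lt_ciSup hc
    obtain ⟨y, rfl⟩ : ∃ z, ultraMk F M z = y := ⟨_, ultraMk_out F M y⟩
    filter_upwards [(h y).eventually_const_lt hy] with i hi
    exact hi.trans_le (le_ciSup (bddAbove_range_of_abs_le (hf i)) _)
  · obtain ⟨d, hd1, hd2⟩ := exists_between hc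
    have hy : ∀ i, ∃ y, (⨆ y, f i y) - (c - d) < f i y := fun i =>
      exists_lt_of_lt_ciSup (by linarith)
    choose y hy using hy
    have h1 : g (ultraMk F M y) < d :=
      (le_ciSup (bddAbove_range_of_abs_le hg) (ultraMk F M y)).trans_lt hd1
    filter_upwards [(h y).eventually_lt_const h1] with i hi
    linarith [hy i]

theorem tendsto_iInf_ultraproduct {f : ∀ i, M i → ℝ} {g : ultraproduct F M → ℝ} {C : ℝ}
    (hf : ∀ i y, |f i y| ≤ C)
    (h : ∀ y : ∀ i, M i, Tendsto (fun i => f i (y i)) F (𝓝 (g (ultraMk F M y)))) :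
    Tendsto (fun i => ⨅ y, f i y) F (𝓝 (⨅ y, g y)) := by
  simp only [iInf_eq_neg_iSup_neg]
  exact (tendsto_iSup_ultraproduct F M (f := fun i y => -f i y) (g := fun y => -g y) (C := C)
    (fun i y => by rw [abs_neg]; exact hf i y) fun y => (h y).neg).neg

/-- **Łoś's theorem**: the value of an affine formula in an ultraproduct is the limit of its values
in the factors. -/
theorem tendsto_evalBounded {α : Type u} (v : α → ∀ i, M i) {n : ℕ} (φ : BoundedFormula L α n)
    (x : Fin n → ∀ i, M i) :
    Tendsto (fun i => evalBounded (M i) (fun a => v a i) φ fun k => x k i) F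
      (𝓝 (evalBounded (ultraproduct F M) (fun a => ultraMk F M (v a)) φ
        fun k => ultraMk F M (x k))) := by
  have hterm : ∀ {n : ℕ} (x : Fin n → ∀ i, M i) (t : L.toLanguage.Term (α ⊕ Fin n)),
      termValue (ultraproduct F M)
        (Sum.elim (fun a => ultraMk F M (v a)) fun k => ultraMk F M (x k)) t =
      ultraMk F M fun i => termValue (M i) (Sum.elim (fun a => v a i) fun k => x k i) t := by
    intro n x t
    have h1 : (Sum.elim (fun a => ultraMk F M (v a)) fun k => ultraMk F M (x k)) =
      fun b => ultraMk F M (Sum.elim v x b) := by funext b; cases b <;> rfl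
    have h2 : ∀ i, (Sum.elim (fun a => v a i) fun k => x k i) = fun b => Sum.elim v x b i := by
      intro i; funext b; cases b <;> rfl
    simp only [h2]
    rw [← termValue_ultraproduct, ← h1]
    rfl
  have hsnoc : ∀ {n : ℕ} (x : Fin n → ∀ i, M i) (y : ∀ i, M i) (i : I),
      (fun k => (Fin.snoc x y : Fin (n + 1) → ∀ i, M i) k i) =
        Fin.snoc (fun k => x k i) (y i) :=
    fun x y i => Fin.comp_snoc (fun z : ∀ i, M i => z i) x y
  have hsnoc' : ∀ {n : ℕ} (x : Fin n → ∀ i, M i) (y : ∀ i, M i),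
      (fun k => ultraMk F M ((Fin.snoc x y : Fin (n + 1) → ∀ i, M i) k)) =
        Fin.snoc (fun k => ultraMk F M (x k)) (ultraMk F M y) :=
    fun x y => Fin.comp_snoc (ultraMk F M) x y
  induction φ with
  | one => exact tendsto_const_nhds
  | rel R ts =>
    simp only [evalBounded]
    rw [funext fun k => hterm x (ts k)]
    rw [ultraproduct_relMap_mk]
    exact tendsto_relMap F M R _
  | metric t₁ t₂ =>
    simp only [evalBounded]
    rw [hterm, hterm]
    exact tendsto_dist_mk F M _ _
  | smul r φ ih => exact (ih x).const_mul r
  | add φ ψ ihφ ihψ => exact (ihφ x).add (ihψ x)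
  | inf φ ih =>
    obtain ⟨C, hC⟩ := exists_bound φ
    refine tendsto_iInf_ultraproduct F M (C := C) (fun i y => hC _ _ _) fun y => ?_
    have := ih (Fin.snoc x y)
    simp only [hsnoc] at this
    rwa [hsnoc'] at this
  | sup φ ih =>
    obtain ⟨C, hC⟩ := exists_bound φ
    refine tendsto_iSup_ultraproduct F M (C := C) (fun i y => hC _ _ _) fun y => ?_
    have := ih (Fin.snoc x y)
    simp only [hsnoc] at this
    rwa [hsnoc'] at this

theorem tendsto_eval {α : Type u} (v : α → ∀ i, M i) (φ : Formula L α) :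
    Tendsto (fun i => eval (M i) (fun a => v a i) φ) F
      (𝓝 (eval (ultraproduct F M) (fun a => ultraMk F M (v a)) φ)) := by
  have h := tendsto_evalBounded F M v φ Fin.elim0
  simp only [Subsingleton.elim (fun k : Fin 0 => _) Fin.elim0] at h
  exact h

end Los

/-! ### Weighted means of two structures -/

section Mean

variable (N₁ N₂ : MetricStructure L) (w : Set.Ioo (0 : ℝ) 1)

/-- The product of two structures, to be given the weighted mean of the two metrics. -/
def MeanCarrier (_w : Set.Ioo (0 : ℝ) 1) : Type u := N₁ × N₂

variable {N₁ N₂ w} in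
/-- The first coordinate. -/
def MeanCarrier.fst (p : MeanCarrier N₁ N₂ w) : N₁ := Prod.fst p

variable {N₁ N₂ w} in
/-- The second coordinate. -/
def MeanCarrier.snd (p : MeanCarrier N₁ N₂ w) : N₂ := Prod.snd p

/-- The element with given coordinates. -/
def MeanCarrier.mk (y : N₁) (z : N₂) : MeanCarrier N₁ N₂ w := (y, z)

theorem MeanCarrier.weight_pos : 0 < (w : ℝ) ∧ 0 < 1 - (w : ℝ) := ⟨w.2.1, sub_pos.2 w.2.2⟩

noncomputable instance : MetricSpace (MeanCarrier N₁ N₂ w) where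
  dist p q := w * dist p.fst q.fst + (1 - w) * dist p.snd q.snd
  dist_self p := by simp
  dist_comm p q := by simp only [dist_comm]
  dist_triangle p q r := by
    have h := MeanCarrier.weight_pos w
    have h1 := mul_le_mul_of_nonneg_left (dist_triangle p.fst q.fst r.fst) h.1.le
    have h2 := mul_le_mul_of_nonneg_left (dist_triangle p.snd q.snd r.snd) h.2.le
    linarith
  eq_of_dist_eq_zero {p q} h := by
    have hw := MeanCarrier.weight_pos w
    have h1 : (0 : ℝ) ≤ w * dist p.fst q.fst := mul_nonneg hw.1.le dist_nonneg
    have h2 : (0 : ℝ) ≤ (1 - w) * dist p.snd q.snd := mul_nonneg hw.2.le dist_nonneg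
    have h3 := (add_eq_zero_iff_of_nonneg h1 h2).1 h
    exact Prod.ext (dist_eq_zero.1 ((mul_eq_zero.1 h3.1).resolve_left hw.1.ne'))
      (dist_eq_zero.1 ((mul_eq_zero.1 h3.2).resolve_left hw.2.ne'))

theorem MeanCarrier.dist_def (p q : MeanCarrier N₁ N₂ w) :
    dist p q = w * dist p.fst q.fst + (1 - w) * dist p.snd q.snd := rfl

instance : CompleteSpace (MeanCarrier N₁ N₂ w) := by
  have hw := MeanCarrier.weight_pos w
  refine Metric.complete_of_cauchySeq_tendsto fun u hu => ?_
  have h1 : CauchySeq fun n => (u n).fst := by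
    refine Metric.cauchySeq_iff.2 fun ε hε => ?_
    obtain ⟨K, hK⟩ := Metric.cauchySeq_iff.1 hu (w * ε) (mul_pos hw.1 hε)
    refine ⟨K, fun m hm n hn => lt_of_mul_lt_mul_left ?_ hw.1.le⟩
    have h := hK m hm n hn
    rw [MeanCarrier.dist_def] at h
    have h2 : (0 : ℝ) ≤ (1 - w) * dist (u m).snd (u n).snd := mul_nonneg hw.2.le dist_nonneg
    linarith
  have h2 : CauchySeq fun n => (u n).snd := by
    refine Metric.cauchySeq_iff.2 fun ε hε => ?_
    obtain ⟨K, hK⟩ := Metric.cauchySeq_iff.1 hu ((1 - w) * ε) (mul_pos hw.2 hε)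
    refine ⟨K, fun m hm n hn => lt_of_mul_lt_mul_left ?_ hw.2.le⟩
    have h := hK m hm n hn
    rw [MeanCarrier.dist_def] at h
    have h2 : (0 : ℝ) ≤ w * dist (u m).fst (u n).fst := mul_nonneg hw.1.le dist_nonneg
    linarith
  obtain ⟨y, hy⟩ := cauchySeq_tendsto_of_complete h1
  obtain ⟨z, hz⟩ := cauchySeq_tendsto_of_complete h2
  refine ⟨MeanCarrier.mk N₁ N₂ w y z, tendsto_iff_dist_tendsto_zero.2 ?_⟩
  have h := ((tendsto_iff_dist_tendsto_zero.1 hy).const_mul (w : ℝ)).add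
    ((tendsto_iff_dist_tendsto_zero.1 hz).const_mul (1 - w : ℝ))
  rwa [mul_zero, mul_zero, add_zero] at h

/-- The mean of two structures with weights `w` and `1 - w`: function symbols act coordinatewise,
relations and the metric are averaged. The weights are positive, so that this is a metric. -/
noncomputable def MetricStructure.mean : MetricStructure L where
  carrier := MeanCarrier N₁ N₂ w
  nonempty := ⟨MeanCarrier.mk N₁ N₂ w (Classical.arbitrary _) (Classical.arbitrary _)⟩
  dist_le_one p q := by
    have hw := MeanCarrier.weight_pos w
    rw [MeanCarrier.dist_def]
    have h1 := mul_le_mul_of_nonneg_left (N₁.dist_le_one p.fst q.fst) hw.1.le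
    have h2 := mul_le_mul_of_nonneg_left (N₂.dist_le_one p.snd q.snd) hw.2.le
    linarith
  funMap f x := MeanCarrier.mk N₁ N₂ w (N₁.funMap f fun k => (x k).fst)
    (N₂.funMap f fun k => (x k).snd)
  relMap R x := w * N₁.relMap R (fun k => (x k).fst) + (1 - w) * N₂.relMap R fun k => (x k).snd
  funMap_lipschitz f x y := by
    have hw := MeanCarrier.weight_pos w
    have h1 := mul_le_mul_of_nonneg_left
      (N₁.funMap_lipschitz f (fun k => (x k).fst) fun k => (y k).fst) hw.1.le
    have h2 := mul_le_mul_of_nonneg_left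
      (N₂.funMap_lipschitz f (fun k => (x k).snd) fun k => (y k).snd) hw.2.le
    simp only [MeanCarrier.dist_def, Finset.sum_add_distrib, ← Finset.mul_sum]
    refine (add_le_add h1 h2).trans_eq ?_
    ring
  relMap_mem R x := by
    have hw := MeanCarrier.weight_pos w
    have h1 := N₁.relMap_mem R fun k => (x k).fst
    have h2 := N₂.relMap_mem R fun k => (x k).snd
    exact ⟨add_nonneg (mul_nonneg hw.1.le h1.1) (mul_nonneg hw.2.le h2.1), by
      have h3 := mul_le_mul_of_nonneg_left h1.2 hw.1.le
      have h4 := mul_le_mul_of_nonneg_left h2.2 hw.2.le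
      linarith⟩
  relMap_lipschitz R x y := by
    have hw := MeanCarrier.weight_pos w
    have h1 := mul_le_mul_of_nonneg_left
      (N₁.relMap_lipschitz R (fun k => (x k).fst) fun k => (y k).fst) hw.1.le
    have h2 := mul_le_mul_of_nonneg_left
      (N₂.relMap_lipschitz R (fun k => (x k).snd) fun k => (y k).snd) hw.2.le
    simp only [MeanCarrier.dist_def, Finset.sum_add_distrib, ← Finset.mul_sum]
    rw [add_sub_add_comm, ← mul_sub, ← mul_sub]
    refine (abs_add_le _ _).trans ?_
    rw [abs_mul, abs_mul, abs_of_pos hw.1, abs_of_pos hw.2]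
    refine (add_le_add h1 h2).trans_eq ?_
    ring

variable {N₁ N₂ w} in
/-- The first coordinate of an element of a mean. -/
def meanFst (p : N₁.mean N₂ w) : N₁ := MeanCarrier.fst (w := w) p

variable {N₁ N₂ w} in
/-- The second coordinate of an element of a mean. -/
def meanSnd (p : N₁.mean N₂ w) : N₂ := MeanCarrier.snd (w := w) p

theorem termValue_mean {β : Type u} (v : β → N₁.mean N₂ w) (t : L.toLanguage.Term β) :
    termValue (N₁.mean N₂ w) v t = MeanCarrier.mk N₁ N₂ w
      (termValue N₁ (fun b => meanFst (v b)) t) (termValue N₂ (fun b => meanSnd (v b)) t) := by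
  induction t with
  | var b => rfl
  | func f ts ih =>
    simp only [termValue]
    rw [funext ih]
    rfl

theorem iSup_mean {f : N₁ → ℝ} {g : N₂ → ℝ} {C : ℝ} (hf : ∀ y, |f y| ≤ C) (hg : ∀ z, |g z| ≤ C) :
    ⨆ p : N₁.mean N₂ w, ((w : ℝ) * f (meanFst p) + (1 - w) * g (meanSnd p)) =
      w * (⨆ y, f y) + (1 - w) * ⨆ z, g z := by
  have hw := MeanCarrier.weight_pos w
  have hle : ∀ p : N₁.mean N₂ w, (w : ℝ) * f (meanFst p) + (1 - w) * g (meanSnd p) ≤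
      w * (⨆ y, f y) + (1 - w) * ⨆ z, g z := fun p =>
    add_le_add
      (mul_le_mul_of_nonneg_left (le_ciSup (bddAbove_range_of_abs_le hf) (meanFst p)) hw.1.le)
      (mul_le_mul_of_nonneg_left (le_ciSup (bddAbove_range_of_abs_le hg) (meanSnd p)) hw.2.le)
  refine ciSup_eq_of_forall_le_of_forall_lt_exists_gt hle fun c hc => ?_
  obtain ⟨δ, hδ, hδc⟩ : ∃ δ > 0, c + δ = w * (⨆ y, f y) + (1 - w) * ⨆ z, g z :=
    ⟨_, sub_pos.2 hc, by ring⟩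
  obtain ⟨y, hy⟩ := exists_lt_of_lt_ciSup (f := f) (sub_lt_self (⨆ y, f y) hδ)
  obtain ⟨z, hz⟩ := exists_lt_of_lt_ciSup (f := g) (sub_lt_self (⨆ z, g z) hδ)
  refine ⟨MeanCarrier.mk N₁ N₂ w y z, ?_⟩
  have h1 := mul_lt_mul_of_pos_left hy hw.1
  have h2 := mul_lt_mul_of_pos_left hz hw.2
  change c < w * f y + (1 - w) * g z
  linarith

theorem iInf_mean {f : N₁ → ℝ} {g : N₂ → ℝ} {C : ℝ} (hf : ∀ y, |f y| ≤ C) (hg : ∀ z, |g z| ≤ C) :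
    ⨅ p : N₁.mean N₂ w, ((w : ℝ) * f (meanFst p) + (1 - w) * g (meanSnd p)) =
      w * (⨅ y, f y) + (1 - w) * ⨅ z, g z := by
  have h := iSup_mean N₁ N₂ w (f := fun y => -f y) (g := fun z => -g z) (C := C)
    (fun y => by rw [abs_neg]; exact hf y) (fun y => by rw [abs_neg]; exact hg y)
  simp only [iInf_eq_neg_iSup_neg, neg_add, ← mul_neg]
  rw [h]
  ring

theorem evalBounded_mean {α : Type u} (v : α → N₁.mean N₂ w) {n : ℕ} (φ : BoundedFormula L α n)
    (x : Fin n → N₁.mean N₂ w) :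
    evalBounded (N₁.mean N₂ w) v φ x =
      w * evalBounded N₁ (fun a => meanFst (v a)) φ (fun k => meanFst (x k)) +
        (1 - w) * evalBounded N₂ (fun a => meanSnd (v a)) φ fun k => meanSnd (x k) := by
  have helim₁ : ∀ {n : ℕ} (x : Fin n → N₁.mean N₂ w),
      (fun b => meanFst (Sum.elim v x b)) = Sum.elim (fun a => meanFst (v a)) fun k => meanFst (x k) := by
    intro n x; funext b; cases b <;> rfl
  have helim₂ : ∀ {n : ℕ} (x : Fin n → N₁.mean N₂ w),
      (fun b => meanSnd (Sum.elim v x b)) = Sum.elim (fun a => meanSnd (v a)) fun k => meanSnd (x k) := by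
    intro n x; funext b; cases b <;> rfl
  have hsnoc₁ : ∀ {n : ℕ} (x : Fin n → N₁.mean N₂ w) (y : N₁.mean N₂ w),
      (fun k => meanFst ((Fin.snoc x y : Fin (n + 1) → N₁.mean N₂ w) k)) =
        Fin.snoc (fun k => meanFst (x k)) (meanFst y) :=
    fun x y => Fin.comp_snoc meanFst x y
  have hsnoc₂ : ∀ {n : ℕ} (x : Fin n → N₁.mean N₂ w) (y : N₁.mean N₂ w),
      (fun k => meanSnd ((Fin.snoc x y : Fin (n + 1) → N₁.mean N₂ w) k)) =
        Fin.snoc (fun k => meanSnd (x k)) (meanSnd y) :=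
    fun x y => Fin.comp_snoc meanSnd x y
  induction φ with
  | one => simp [evalBounded]
  | rel R ts =>
    simp only [evalBounded, termValue_mean, helim₁, helim₂]
    rfl
  | metric t₁ t₂ =>
    simp only [evalBounded, termValue_mean, helim₁, helim₂]
    rfl
  | smul r φ ih =>
    simp only [evalBounded, ih]
    ring
  | add φ ψ ihφ ihψ =>
    simp only [evalBounded, ihφ, ihψ]
    ring
  | inf φ ih =>
    obtain ⟨C, hC⟩ := exists_bound φ
    simp only [evalBounded, ih, hsnoc₁, hsnoc₂]
    exact iInf_mean N₁ N₂ w (fun y => hC _ _ _) fun z => hC _ _ _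
  | sup φ ih =>
    obtain ⟨C, hC⟩ := exists_bound φ
    simp only [evalBounded, ih, hsnoc₁, hsnoc₂]
    exact iSup_mean N₁ N₂ w (fun y => hC _ _ _) fun z => hC _ _ _

theorem eval_mean {α : Type u} (v : α → N₁.mean N₂ w) (φ : Formula L α) :
    eval (N₁.mean N₂ w) v φ = w * eval N₁ (fun a => meanFst (v a)) φ +
      (1 - w) * eval N₂ (fun a => meanSnd (v a)) φ := by
  have h := evalBounded_mean N₁ N₂ w v φ Fin.elim0
  rw [Subsingleton.elim (fun k : Fin 0 => _) Fin.elim0,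
    Subsingleton.elim (fun k : Fin 0 => meanSnd _) Fin.elim0] at h
  exact h

end Mean

/-! ### The space of types is convex and compact -/

section TypeSpace

variable (M : MetricStructure L) (A : Set M) (n : ℕ)

@[simp]
theorem eval_smul {α : Type u} (N : MetricStructure L) (v : α → N) (r : ℝ) (φ : Formula L α) :
    eval N v (.smul r φ) = r * eval N v φ := rfl

@[simp]
theorem eval_add {α : Type u} (N : MetricStructure L) (v : α → N) (φ ψ : Formula L α) :
    eval N v (.add φ ψ) = eval N v φ + eval N v ψ := rfl

@[simp]
theorem eval_one {α : Type u} (N : MetricStructure L) (v : α → N) :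
    eval N v (.one : Formula L α) = 1 := rfl

/-- The types over `A`, as functionals, are the evaluation functionals of tuples in models of the
theory of `(M, a)_{a ∈ A}`: a partial type that fixes the value of every formula is maximal. -/
theorem mem_typeSpace_iff {p : ParamFormula M A n → ℝ} :
    p ∈ typeSpace M A n ↔ ∃ (N : MetricStructure L) (c : A → N) (b : Fin n → N),
      IsModelOver M A N c ∧ ∀ φ, eval N (Sum.elim c b) φ = p φ := by
  constructor
  · rintro ⟨Γ, hΓ, hp⟩
    obtain ⟨N, c, b, hN, hb⟩ := hΓ.prop
    refine ⟨N, c, b, hN, fun φ => le_antisymm ?_ ?_⟩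
    · simpa using hb _ (hp φ).1
    · simpa using hb _ (hp φ).2
  · rintro ⟨N, c, b, hN, hb⟩
    have hr : ∀ φ, eval N (Sum.elim c b) φ ≤ eval N (Sum.elim c b) (.smul (p φ) .one) ∧
        eval N (Sum.elim c b) (.smul (p φ) .one) ≤ eval N (Sum.elim c b) φ := fun φ => by
      rw [eval_smul, eval_one, mul_one, hb]
      exact ⟨le_rfl, le_rfl⟩
    refine ⟨{q | eval N (Sum.elim c b) q.1 ≤ eval N (Sum.elim c b) q.2},
      ⟨⟨N, c, b, hN, fun q hq => hq⟩, ?_⟩, fun φ => hr φ⟩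
    rintro Γ ⟨N', c', b', hN', hb'⟩ hΓ q hq
    have h : ∀ φ, eval N' (Sum.elim c' b') φ = p φ := fun φ => by
      refine le_antisymm ?_ ?_
      · simpa using hb' (φ, .smul (p φ) .one) (hΓ (hr φ).1)
      · simpa using hb' (.smul (p φ) .one, φ) (hΓ (hr φ).2)
    have h1 := hb' q hq
    rw [h, h] at h1
    simpa [hb] using h1

/-- The evaluation functional of a tuple of `M`. -/
noncomputable def realizedType (b : Fin n → M) : ParamFormula M A n → ℝ :=
  fun φ => eval M (Sum.elim (fun a : A => (a : M)) b) φ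

theorem realizedType_mem (b : Fin n → M) : realizedType M A n b ∈ typeSpace M A n :=
  (mem_typeSpace_iff M A n).2 ⟨M, fun a => a, b, fun _ => rfl, fun _ => rfl⟩

theorem convex_typeSpace : Convex ℝ (typeSpace M A n) := by
  rw [convex_iff_forall_pos]
  intro p hp q hq s t hs ht hst
  obtain ⟨N₁, c₁, b₁, h₁, hp⟩ := (mem_typeSpace_iff M A n).1 hp
  obtain ⟨N₂, c₂, b₂, h₂, hq⟩ := (mem_typeSpace_iff M A n).1 hq
  let w : Set.Ioo (0 : ℝ) 1 := ⟨s, hs, by linarith⟩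
  obtain rfl : t = 1 - s := by linarith
  refine (mem_typeSpace_iff M A n).2 ⟨N₁.mean N₂ w, fun a => MeanCarrier.mk N₁ N₂ w (c₁ a) (c₂ a),
    fun k => MeanCarrier.mk N₁ N₂ w (b₁ k) (b₂ k), fun σ => ?_, fun φ => ?_⟩
  · refine (eval_mean N₁ N₂ w _ σ).trans ?_
    change s * eval N₁ c₁ σ + (1 - s) * eval N₂ c₂ σ = _
    rw [h₁, h₂]
    ring
  · refine (eval_mean N₁ N₂ w _ φ).trans ?_
    rw [Pi.add_apply, Pi.smul_apply, Pi.smul_apply, ← hp, ← hq]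
    congr 3
    all_goals
      funext a
      cases a <;> rfl

/-- Affine compactness: a limit of types along an ultrafilter is realized in an ultraproduct of
models in which these types are realized. -/
theorem isClosed_typeSpace : IsClosed (typeSpace M A n) := by
  rw [isClosed_iff_ultrafilter]
  intro p U hU hS
  have h : ∀ q : ParamFormula M A n → ℝ, ∃ (N : MetricStructure L) (c : A → N) (b : Fin n → N),
      IsModelOver M A N c ∧ (q ∈ typeSpace M A n → ∀ φ, eval N (Sum.elim c b) φ = q φ) := by
    intro q
    by_cases hq : q ∈ typeSpace M A n
    · obtain ⟨N, c, b, hN, hb⟩ := (mem_typeSpace_iff M A n).1 hq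
      exact ⟨N, c, b, hN, fun _ => hb⟩
    · exact ⟨M, fun a => a, fun _ => Classical.arbitrary M, fun _ => rfl, fun h => absurd h hq⟩
  choose N c b hN hb using h
  refine (mem_typeSpace_iff M A n).2 ⟨ultraproduct U N, fun a => ultraMk U N fun q => c q a,
    fun k => ultraMk U N fun q => b q k, fun σ => ?_, fun φ => ?_⟩
  · refine tendsto_nhds_unique (tendsto_eval U N (fun a q => c q a) σ) ?_
    exact tendsto_const_nhds.congr fun q => (hN q σ).symm
  · have h1 := tendsto_eval U N (Sum.elim (fun a q => c q a) fun k q => b q k) φ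
    have h2 : (fun a => ultraMk U N
        ((Sum.elim (fun a q => c q a) fun k q => b q k : A ⊕ Fin n → ∀ q, N q) a)) =
        Sum.elim (fun a => ultraMk U N fun q => c q a) fun k => ultraMk U N fun q => b q k := by
      funext a; cases a <;> rfl
    rw [h2] at h1
    refine tendsto_nhds_unique h1 ?_
    have h3 : Tendsto (fun q : ParamFormula M A n → ℝ => q φ) U (𝓝 (p φ)) :=
      ((continuous_apply φ).tendsto p).mono_left hU
    refine h3.congr' ?_
    filter_upwards [hS] with q hq
    rw [← hb q hq φ]
    congr 1
    funext a
    cases a <;> rfl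

theorem isCompact_typeSpace : IsCompact (typeSpace M A n) := by
  choose C hC using fun φ : ParamFormula M A n => exists_bound φ
  refine (isCompact_univ_pi fun φ => isCompact_Icc (a := -C φ) (b := C φ)).of_isClosed_subset
    (isClosed_typeSpace M A n) fun p hp φ _ => ?_
  obtain ⟨N, c, b, -, hb⟩ := (mem_typeSpace_iff M A n).1 hp
  rw [← hb φ]
  exact abs_le.1 (hC φ N _ _)

end TypeSpace

/-! ### Milman's converse to the Krein–Milman theorem -/

section Milman

variable {E : Type*} [AddCommGroup E] [Module ℝ E] [TopologicalSpace E] [IsTopologicalAddGroup E]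
  [ContinuousSMul ℝ E]

theorem isCompact_convexJoin {s t : Set E} (hs : IsCompact s) (ht : IsCompact t) :
    IsCompact (convexJoin ℝ s t) := by
  have h : convexJoin ℝ s t =
      (fun q : ℝ × E × E => (1 - q.1) • q.2.1 + q.1 • q.2.2) '' Set.Icc 0 1 ×ˢ s ×ˢ t := by
    ext x
    simp only [mem_convexJoin, segment_eq_image, Set.mem_image, Set.mem_prod, Prod.exists]
    constructor
    · rintro ⟨a, ha, b, hb, r, hr, rfl⟩
      exact ⟨r, a, b, ⟨hr, ha, hb⟩, rfl⟩
    · rintro ⟨r, a, b, ⟨hr, ha, hb⟩, rfl⟩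
      exact ⟨a, ha, b, hb, r, hr, rfl⟩
  rw [h]
  exact (isCompact_Icc.prod (hs.prod ht)).image (by fun_prop)

/-- The closed convex hull of a union of two sets consists of the convex combinations of points of
the two closed convex hulls, when these are compact; an extreme point lies in one of them. -/
theorem mem_closedConvexHull_or_of_mem_extremePoints [T2Space E] {S s t : Set E} {p : E}
    (hS : IsCompact S) (hconv : Convex ℝ S) (hs : s ⊆ S) (ht : t ⊆ S)
    (hp : p ∈ S.extremePoints ℝ) (h : p ∈ closedConvexHull ℝ (s ∪ t)) :
    p ∈ closedConvexHull ℝ s ∨ p ∈ closedConvexHull ℝ t := by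
  rcases s.eq_empty_or_nonempty with rfl | hs₀
  · right; simpa using h
  rcases t.eq_empty_or_nonempty with rfl | ht₀
  · left; simpa using h
  have hsS : closedConvexHull ℝ s ⊆ S := closedConvexHull_min hs hconv hS.isClosed
  have htS : closedConvexHull ℝ t ⊆ S := closedConvexHull_min ht hconv hS.isClosed
  have hcomp := isCompact_convexJoin (hS.of_isClosed_subset isClosed_closedConvexHull hsS)
    (hS.of_isClosed_subset isClosed_closedConvexHull htS)
  have hsub : closedConvexHull ℝ (s ∪ t) ⊆
      convexJoin ℝ (closedConvexHull ℝ s) (closedConvexHull ℝ t) := by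
    refine closedConvexHull_min (Set.union_subset ?_ ?_)
      (convex_closedConvexHull.convexJoin convex_closedConvexHull) hcomp.isClosed
    · exact subset_closedConvexHull.trans
        (subset_convexJoin_left (ht₀.mono subset_closedConvexHull))
    · exact subset_closedConvexHull.trans
        (subset_convexJoin_right (hs₀.mono subset_closedConvexHull))
  obtain ⟨a, ha, b, hb, hab⟩ := mem_convexJoin.1 (hsub h)
  rcases (mem_extremePoints_iff_forall_segment.1 hp).2 a (hsS ha) b (htS hb) hab with rfl | rfl
  · exact Or.inl ha
  · exact Or.inr hb

/-- **Milman's theorem**: if a compact convex set is contained in the closed convex hull of a subset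
`K`, then its extreme points lie in the closure of `K`. -/
theorem extremePoints_subset_closure_of_subset_closedConvexHull [T2Space E] [LocallyConvexSpace ℝ E]
    {S K : Set E} (hS : IsCompact S) (hconv : Convex ℝ S) (hK : K ⊆ S)
    (hSK : S ⊆ closedConvexHull ℝ K) : S.extremePoints ℝ ⊆ closure K := by
  intro p hp
  by_contra hpK
  have hcomp : IsCompact (closure K) :=
    hS.of_isClosed_subset isClosed_closure (closure_minimal hK hS.isClosed)
  -- `p` avoids the closed convex hull of every piece of `K` that a closed half-space separates
  -- from `p`; finitely many such half-spaces cover `closure K`.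
  have key : p ∉ closedConvexHull ℝ (K ∩ closure K) := by
    refine hcomp.induction_on (p := fun T => p ∉ closedConvexHull ℝ (K ∩ T)) ?_ ?_ ?_ ?_
    · rw [Set.inter_empty]
      exact fun h => closedConvexHull_min (t := ∅) subset_rfl convex_empty isClosed_empty h
    · intro T T' hT hT' h
      exact hT' ((closedConvexHull ℝ).monotone (Set.inter_subset_inter_right K hT) h)
    · intro T T' hT hT' h
      rw [Set.inter_union_distrib_left] at h
      exact (mem_closedConvexHull_or_of_mem_extremePoints hS hconv
        (Set.inter_subset_left.trans hK) (Set.inter_subset_left.trans hK) hp h).elim hT hT'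
    · intro x hx
      have hne : p ≠ x := by
        rintro rfl
        exact hpK hx
      obtain ⟨f, hf⟩ := geometric_hahn_banach_point_point hne
      obtain ⟨c, hc₁, hc₂⟩ := exists_between hf
      refine ⟨{y | c ≤ f y}, mem_nhdsWithin_of_mem_nhds ?_, fun h => ?_⟩
      · filter_upwards [(f.continuous.tendsto x).eventually_const_lt hc₂] with y hy
        exact hy.le
      · have h1 : closedConvexHull ℝ (K ∩ {y | c ≤ f y}) ⊆ {y | c ≤ f y} :=
          closedConvexHull_min Set.inter_subset_right
            (convex_halfSpace_ge f.toLinearMap.isLinear c)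
            (isClosed_le continuous_const f.continuous)
        exact absurd (h1 h) (not_le.2 hc₁)
  rw [Set.inter_eq_left.2 subset_closure] at key
  exact key (hSK hp.1)

/-- A continuous linear functional on a product of lines depends on finitely many coordinates. -/
theorem exists_finset_forall_eq_sum {ι : Type*} (f : (ι → ℝ) →L[ℝ] ℝ) :
    ∃ (J : Finset ι) (c : ι → ℝ), ∀ x, f x = ∑ j ∈ J, c j * x j := by
  classical
  have h : {x : ι → ℝ | f x < 1} ∈ 𝓝 (0 : ι → ℝ) :=
    (f.continuous.tendsto 0).eventually_lt_const (by rw [map_zero]; exact one_pos)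
  rw [nhds_pi, Filter.mem_pi] at h
  obtain ⟨J, hJ, t, ht, hsub⟩ := h
  have hzero : ∀ x : ι → ℝ, (∀ j ∈ J, x j = 0) → f x = 0 := by
    intro x hx
    by_contra hne
    have h1 : (f x)⁻¹ • x ∈ J.pi t := fun j hj => by
      rw [Pi.smul_apply, hx j hj, smul_zero]
      exact mem_of_mem_nhds (ht j)
    have h2 : f ((f x)⁻¹ • x) < 1 := hsub h1
    rw [map_smul, smul_eq_mul, inv_mul_cancel₀ hne] at h2
    exact lt_irrefl _ h2
  refine ⟨hJ.toFinset, fun j => f (Pi.single j 1), fun x => ?_⟩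
  have h1 := hzero (x - ∑ j ∈ hJ.toFinset, x j • Pi.single j (1 : ℝ)) fun j hj => by
    rw [Pi.sub_apply, Finset.sum_apply, Finset.sum_eq_single j]
    · simp
    · intro k _ hk
      simp [hk.symm]
    · intro h
      exact absurd (hJ.mem_toFinset.2 hj) h
  rw [map_sub, sub_eq_zero, map_sum] at h1
  rw [h1]
  exact Finset.sum_congr rfl fun j _ => by rw [map_smul, smul_eq_mul, mul_comm]

end Milman

/-! ### Extreme types are limits of realized types -/

theorem termValue_relabel {α β : Type u} (N : MetricStructure L) (g : α → β) (v : β → N)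
    (t : L.toLanguage.Term α) : termValue N v (t.relabel g) = termValue N (v ∘ g) t := by
  induction t with
  | var a => rfl
  | func f ts ih =>
    simp only [FirstOrder.Language.Term.relabel, termValue]
    rw [funext ih]

/-- Turn `n` free variables into bindable ones, placed before those already there. -/
def BoundedFormula.makeBound {α : Type u} {n : ℕ} :
    ∀ {m : ℕ}, BoundedFormula L (α ⊕ Fin n) m → BoundedFormula L α (n + m)
  | _, .one => .one
  | _, .rel R ts => .rel R fun i => (ts i).relabel
      (Sum.elim (Sum.map id (Fin.castAdd _)) fun k => Sum.inr (Fin.natAdd n k))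
  | _, .metric t₁ t₂ => .metric
      (t₁.relabel (Sum.elim (Sum.map id (Fin.castAdd _)) fun k => Sum.inr (Fin.natAdd n k)))
      (t₂.relabel (Sum.elim (Sum.map id (Fin.castAdd _)) fun k => Sum.inr (Fin.natAdd n k)))
  | _, .smul r φ => .smul r φ.makeBound
  | _, .add φ ψ => .add φ.makeBound ψ.makeBound
  | _, .inf φ => .inf φ.makeBound
  | _, .sup φ => .sup φ.makeBound

theorem evalBounded_makeBound {α : Type u} {n m : ℕ} (N : MetricStructure L) (v : α → N)
    (b : Fin n → N) (φ : BoundedFormula L (α ⊕ Fin n) m) (x : Fin m → N) :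
    evalBounded N v φ.makeBound (Fin.append b x) = evalBounded N (Sum.elim v b) φ x := by
  have hv : ∀ {m : ℕ} (x : Fin m → N),
      Sum.elim v (Fin.append b x) ∘
        Sum.elim (Sum.map id (Fin.castAdd m)) (fun k => Sum.inr (Fin.natAdd n k)) =
      Sum.elim (Sum.elim v b) x := by
    intro m x
    funext k
    rcases k with (a | k) | k <;> simp
  induction φ with
  | one => rfl
  | rel R ts => simp only [BoundedFormula.makeBound, evalBounded, termValue_relabel, hv]
  | metric t₁ t₂ => simp only [BoundedFormula.makeBound, evalBounded, termValue_relabel, hv]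
  | smul r φ ih => simp only [BoundedFormula.makeBound, evalBounded, ih]
  | add φ ψ ihφ ihψ => simp only [BoundedFormula.makeBound, evalBounded, ihφ, ihψ]
  | inf φ ih =>
    simp only [BoundedFormula.makeBound, evalBounded]
    exact congrArg iInf (funext fun y => by rw [← ih, Fin.append_snoc])
  | sup φ ih =>
    simp only [BoundedFormula.makeBound, evalBounded]
    exact congrArg iSup (funext fun y => by rw [← ih, Fin.append_snoc])

/-- Quantify all bindable variables by suprema. -/
def BoundedFormula.supAll {α : Type u} : ∀ {n : ℕ}, BoundedFormula L α n → Formula L α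
  | 0, φ => φ
  | _ + 1, φ => supAll (.sup φ)

theorem evalBounded_le_eval_supAll {α : Type u} {n : ℕ} (N : MetricStructure L) (v : α → N)
    (φ : BoundedFormula L α n) (x : Fin n → N) : evalBounded N v φ x ≤ eval N v φ.supAll := by
  induction n with
  | zero => rw [Subsingleton.elim x Fin.elim0]; exact le_rfl
  | succ n ih =>
    obtain ⟨C, hC⟩ := exists_bound φ
    refine le_trans ?_ (ih (.sup φ) (Fin.init x))
    rw [← Fin.snoc_init_self x, Fin.init_snoc]
    exact le_ciSup (f := fun y => evalBounded N v φ (Fin.snoc (Fin.init x) y))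
      (bddAbove_range_of_abs_le fun y => hC _ _ _) (x (Fin.last n))

theorem eval_supAll_le {α : Type u} {n : ℕ} (N : MetricStructure L) (v : α → N)
    (φ : BoundedFormula L α n) {c : ℝ} (h : ∀ x, evalBounded N v φ x ≤ c) :
    eval N v φ.supAll ≤ c := by
  induction n with
  | zero => exact h _
  | succ n ih => exact ih (.sup φ) fun x => ciSup_le fun y => h _

/-- The supremum of a formula with parameters over all tuples is the value of a formula in the
parameters. -/
theorem exists_sup_formula {α : Type u} {n : ℕ} (φ : Formula L (α ⊕ Fin n)) :
    ∃ σ : Formula L α, ∀ (N : MetricStructure L) (v : α → N),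
      (∀ b, eval N (Sum.elim v b) φ ≤ eval N v σ) ∧
        ∀ c, (∀ b, eval N (Sum.elim v b) φ ≤ c) → eval N v σ ≤ c := by
  have h : ∀ (N : MetricStructure L) (v : α → N) (b : Fin n → N),
      evalBounded N v φ.makeBound b = eval N (Sum.elim v b) φ := fun N v b => by
    have h1 := evalBounded_makeBound N v b φ Fin.elim0
    rw [Fin.append_elim0] at h1
    exact h1
  refine ⟨φ.makeBound.supAll, fun N v => ⟨fun b => ?_, fun c hc => ?_⟩⟩
  · rw [← h]
    exact evalBounded_le_eval_supAll N v _ b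
  · exact eval_supAll_le N v _ fun b => (h N v b).trans_le (hc b)

theorem exists_formula_eq_sum {α : Type u} (J : Finset (Formula L α)) (c : Formula L α → ℝ) :
    ∃ ψ : Formula L α, ∀ (N : MetricStructure L) (v : α → N),
      eval N v ψ = ∑ φ ∈ J, c φ * eval N v φ := by
  classical
  induction J using Finset.induction_on with
  | empty => exact ⟨.smul 0 .one, fun N v => by simp⟩
  | insert φ J hφ ih =>
    obtain ⟨ψ, hψ⟩ := ih
    exact ⟨.add (.smul (c φ) φ) ψ, fun N v => by rw [Finset.sum_insert hφ]; simp [hψ]⟩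

section TypeSpace

variable (M : MetricStructure L) (A : Set M) (n : ℕ)

/-- By the Hahn–Banach theorem a type outside the closed convex hull of the realized types would
give some formula a value above its supremum in `M`, which is part of the theory of `M` over `A`. -/
theorem typeSpace_subset_closedConvexHull :
    typeSpace M A n ⊆ closedConvexHull ℝ (Set.range (realizedType M A n)) := by
  intro p hp
  obtain ⟨N, c, b, hN, hb⟩ := (mem_typeSpace_iff M A n).1 hp
  by_contra h
  obtain ⟨f, s, hf, hs⟩ := geometric_hahn_banach_closed_point
    (convex_closedConvexHull (𝕜 := ℝ)) isClosed_closedConvexHull h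
  obtain ⟨J, r, hJ⟩ := exists_finset_forall_eq_sum f
  obtain ⟨ψ, hψ⟩ := exists_formula_eq_sum J r
  obtain ⟨σ, hσ⟩ := exists_sup_formula ψ
  have h1 : f p = eval N (Sum.elim c b) ψ := by
    rw [hJ, hψ]
    exact Finset.sum_congr rfl fun φ _ => by rw [hb]
  have h2 : eval M (fun a : A => (a : M)) σ ≤ s := (hσ M _).2 s fun d => by
    have h3 := hf _ (subset_closedConvexHull (Set.mem_range_self d))
    rw [hJ] at h3
    rw [hψ]
    exact h3.le
  have h4 := (hσ N c).1 b
  rw [hN σ] at h4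
  linarith

theorem extremePoints_typeSpace_subset_closure :
    (typeSpace M A n).extremePoints ℝ ⊆ closure (Set.range (realizedType M A n)) :=
  extremePoints_subset_closure_of_subset_closedConvexHull (isCompact_typeSpace M A n)
    (convex_typeSpace M A n) (Set.range_subset_iff.2 (realizedType_mem M A n))
    (typeSpace_subset_closedConvexHull M A n)

/-- An extreme type is finitely approximable in `M`. -/
theorem exists_approx_of_mem_extremePoints {p : ParamFormula M A n → ℝ}
    (hp : p ∈ (typeSpace M A n).extremePoints ℝ) (J : Finset (ParamFormula M A n))
    {ε : ℝ} (hε : 0 < ε) :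
    ∃ b : Fin n → M, ∀ φ ∈ J,
      |eval M (Sum.elim (fun a : A => (a : M)) b) φ - p φ| < ε := by
  have h := extremePoints_typeSpace_subset_closure M A n hp
  have hU : (J : Set (ParamFormula M A n)).pi (fun φ => Metric.ball (p φ) ε) ∈ 𝓝 p :=
    set_pi_mem_nhds J.finite_toSet fun φ _ => Metric.ball_mem_nhds _ hε
  obtain ⟨_, hq, b, rfl⟩ := mem_closure_iff_nhds.1 h _ hU
  exact ⟨b, fun φ hφ => hq φ hφ⟩

end TypeSpace

/-! ### A small dense family of formulas -/

section Codes

variable (L) (α : Type u)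

/-- Labels of the nodes of the syntax tree of an affine formula with rational coefficients: an atomic
formula (encoded as a first order formula, with equality for the metric and falsity for `1`), scalar
multiplication by a rational number, or one of `add` (`none`), `sup` (`some true`) and `inf`
(`some false`). -/
abbrev CodeLabel : Type u :=
  (Σ n, L.toLanguage.BoundedFormula α n) ⊕ ℚ ⊕ Option Bool

variable {L α} in
/-- The number of immediate subformulas. -/
def CodeLabel.arity : CodeLabel L α → ℕ
  | .inl _ => 0
  | .inr (.inl _) => 1
  | .inr (.inr none) => 2
  | .inr (.inr (some _)) => 1

/-- Syntax trees of affine formulas with rational coefficients. -/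
abbrev Code : Type u := WType fun l : CodeLabel L α => Fin l.arity

instance : Nonempty (Code L α) := ⟨⟨.inl ⟨0, .falsum⟩, Fin.elim0⟩⟩

variable {L α} in
/-- The affine formula with the same terms as an atomic first order formula. -/
def atomFormula {n : ℕ} : L.toLanguage.BoundedFormula α n → BoundedFormula L α n
  | .rel R ts => .rel R ts
  | .equal t₁ t₂ => .metric t₁ t₂
  | _ => .one

variable {L α} in
/-- The affine formula with a given syntax tree and given number of bindable variables. An atomic
formula that has a different number of bindable variables is read as `1`. -/
def Code.decode : Code L α → ∀ n : ℕ, BoundedFormula L α n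
  | ⟨.inl ⟨m, φ⟩, _⟩, n => if h : m = n then h ▸ atomFormula φ else .one
  | ⟨.inr (.inl q), ts⟩, n => .smul q (decode (ts (0 : Fin 1)) n)
  | ⟨.inr (.inr none), ts⟩, n => .add (decode (ts (0 : Fin 2)) n) (decode (ts (1 : Fin 2)) n)
  | ⟨.inr (.inr (some true)), ts⟩, n => .sup (decode (ts (0 : Fin 1)) (n + 1))
  | ⟨.inr (.inr (some false)), ts⟩, n => .inf (decode (ts (0 : Fin 1)) (n + 1))

theorem mk_code_lt {κ : Cardinal.{u}} (hL : L.toLanguage.card < κ) (hα : #α < κ) (hκ : ℵ₀ < κ) :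
    #(Code L α) < κ := by
  refine (WType.cardinalMk_le_max_aleph0_of_finite' (β := fun l : CodeLabel L α =>
    Fin l.arity)).trans_lt (max_lt ?_ hκ)
  have h1 : #(Σ n, L.toLanguage.BoundedFormula α n) < κ := by
    refine FirstOrder.Language.BoundedFormula.card_le.trans_lt (max_lt hκ ?_)
    rw [lift_id, lift_id]
    exact add_lt_of_lt hκ.le hα hL
  have h2 : Cardinal.lift.{u} #(ℚ ⊕ Option Bool) < κ :=
    (Cardinal.lift_le_aleph0.2 mk_le_aleph0).trans_lt hκ
  rw [lift_uzero, mk_sum]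
  exact add_lt_of_lt hκ.le (by simpa using h1) (by simpa using h2)

variable {L α} in
/-- Every affine formula is a uniform limit, over all structures and all assignments, of affine
formulas with rational coefficients. -/
theorem exists_code_approx {n : ℕ} (φ : BoundedFormula L α n) {ε : ℝ} (hε : 0 < ε) :
    ∃ w : Code L α, ∀ (N : MetricStructure L) (v : α → N) (x : Fin n → N),
      |evalBounded N v φ x - evalBounded N v (w.decode n) x| ≤ ε := by
  induction φ generalizing ε with
  | one =>
    refine ⟨⟨.inl ⟨0, .falsum⟩, Fin.elim0⟩, fun N v x => ?_⟩
    simp only [Code.decode]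
    split
    · subst_vars
      simpa [atomFormula] using hε.le
    · simpa using hε.le
  | rel R ts =>
    refine ⟨⟨.inl ⟨_, .rel R ts⟩, Fin.elim0⟩, fun N v x => ?_⟩
    simpa [Code.decode, atomFormula] using hε.le
  | metric t₁ t₂ =>
    refine ⟨⟨.inl ⟨_, .equal t₁ t₂⟩, Fin.elim0⟩, fun N v x => ?_⟩
    simpa [Code.decode, atomFormula] using hε.le
  | smul r φ ih =>
    obtain ⟨C, hC⟩ := exists_bound φ
    obtain ⟨q, hq⟩ := exists_rat_near r (show 0 < ε / 2 / (|C| + 1) by positivity)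
    obtain ⟨w, hw⟩ := ih (show 0 < ε / 2 / (|(q : ℝ)| + 1) by positivity)
    refine ⟨⟨.inr (.inl q), fun _ => w⟩, fun N v x => ?_⟩
    simp only [Code.decode, evalBounded]
    have h1 : |(r - q) * evalBounded N v φ x| ≤ ε / 2 := by
      rw [abs_mul]
      refine (mul_le_mul hq.le (((hC N v x).trans (le_abs_self C)).trans
        (le_add_of_nonneg_right zero_le_one)) (abs_nonneg _) (by positivity)).trans_eq ?_
      field_simp
    have h2 : |(q : ℝ) * (evalBounded N v φ x - evalBounded N v (w.decode _) x)| ≤ ε / 2 := by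
      rw [abs_mul]
      refine (mul_le_mul (le_add_of_nonneg_right zero_le_one) (hw N v x) (abs_nonneg _)
        (by positivity)).trans_eq ?_
      field_simp
    calc _ = |(r - q) * evalBounded N v φ x +
          q * (evalBounded N v φ x - evalBounded N v (w.decode _) x)| := by ring_nf
      _ ≤ ε / 2 + ε / 2 := (abs_add_le _ _).trans (add_le_add h1 h2)
      _ = ε := add_halves ε
  | add φ ψ ihφ ihψ =>
    obtain ⟨w₁, hw₁⟩ := ihφ (half_pos hε)
    obtain ⟨w₂, hw₂⟩ := ihψ (half_pos hε)
    refine ⟨⟨.inr (.inr none), fun k : Fin 2 => if k = 0 then w₁ else w₂⟩, fun N v x => ?_⟩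
    simp only [Code.decode, evalBounded]
    refine (abs_le.2 ?_)
    have h1 := abs_le.1 (hw₁ N v x)
    have h2 := abs_le.1 (hw₂ N v x)
    simp only [if_true, one_ne_zero, if_false]
    constructor <;> linarith
  | inf φ ih =>
    obtain ⟨C, hC⟩ := exists_bound φ
    obtain ⟨w, hw⟩ := ih hε
    refine ⟨⟨.inr (.inr (some false)), fun _ => w⟩, fun N v x => ?_⟩
    simp only [Code.decode, evalBounded]
    exact abs_iInf_sub_iInf_le (fun y => hC _ _ _) fun y => hw _ _ _
  | sup φ ih =>
    obtain ⟨C, hC⟩ := exists_bound φ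
    obtain ⟨w, hw⟩ := ih hε
    refine ⟨⟨.inr (.inr (some true)), fun _ => w⟩, fun N v x => ?_⟩
    simp only [Code.decode, evalBounded]
    exact abs_iSup_sub_iSup_le (fun y => hC _ _ _) fun y => hw _ _ _

end Codes

/-! ### Good ultrafilters -/

section Good

variable {I : Type u} {F : Ultrafilter I}

theorem IsCountablyIncomplete.exists_antitone (hF : IsCountablyIncomplete F) :
    ∃ J : ℕ → Set I, Antitone J ∧ (∀ n, J n ∈ F) ∧ ⋂ n, J n = ∅ := by
  obtain ⟨S, hS, hSF, hnot⟩ : ∃ S : Set (Set I), S.Countable ∧ (∀ s ∈ S, s ∈ F) ∧ ⋂₀ S ∉ F := by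
    by_contra! h
    exact hF ⟨fun S hS hSF => h S hS hSF⟩
  have hne : S.Nonempty := by
    rw [Set.nonempty_iff_ne_empty]
    rintro rfl
    exact hnot (by rw [Set.sInter_empty]; exact Filter.univ_mem)
  obtain ⟨s, rfl⟩ := hS.exists_eq_range hne
  rw [Set.sInter_range] at hnot
  refine ⟨fun n => (⋂ k ∈ Finset.range n, s k) ∩ (⋂ k, s k)ᶜ, fun m n hmn => ?_, fun n => ?_, ?_⟩
  · exact Set.inter_subset_inter_left _ (Set.biInter_subset_biInter_left
      fun k hk => Finset.mem_range.2 ((Finset.mem_range.1 hk).trans_le hmn))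
  · exact Filter.inter_mem ((Filter.biInter_finset_mem _).2 fun k _ => hSF _ (Set.mem_range_self k))
      (Ultrafilter.compl_mem_iff_notMem.2 hnot)
  · refine Set.eq_empty_of_forall_notMem fun i hi => ?_
    rw [Set.mem_iInter] at hi
    refine (hi 0).2 (Set.mem_iInter.2 fun k => ?_)
    exact Set.mem_iInter₂.1 (hi (k + 1)).1 k (Finset.mem_range.2 (Nat.lt_succ_self k))

/-- Along a countably incomplete good ultrafilter, a small family of requirements of which every
finite subfamily can be met in almost all coordinates can be met by a single element of the product.
Countable incompleteness ensures that each coordinate has to meet only finitely many requirements,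
and additivity of the refined function that these can be met together. -/
theorem exists_forall_eventually_of_isGood {κ : Cardinal.{u}} (hF : IsCountablyIncomplete F)
    (hgood : IsGood F κ) {lam : Type u} (hlam : ℵ₀ ≤ #lam) (hlamκ : #lam < κ) {X : I → Type*}
    [∀ i, Nonempty (X i)] (P : lam → ∀ i, X i → Prop)
    (hP : ∀ s : Finset lam, ∀ᶠ i in (F : Filter I), ∃ x, ∀ l ∈ s, P l i x) :
    ∃ x : ∀ i, X i, ∀ l, ∀ᶠ i in (F : Filter I), P l i (x i) := by
  classical
  obtain ⟨J, hJ, hJF, hJempty⟩ := hF.exists_antitone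
  -- the factor `J s.card` allows a coordinate to lie in `g s` only for sets `s` of bounded size
  obtain ⟨g, hgF, hg, hgf⟩ := hgood lam hlam hlamκ
    (fun s => J s.card ∩ {i | ∃ x, ∀ l ∈ s, P l i x})
    (fun s => Filter.inter_mem (hJF _) (hP s)) fun s t hst => Set.inter_subset_inter
      (hJ (Finset.card_le_card hst)) fun i ⟨x, hx⟩ => ⟨x, fun l hl => hx l (hst hl)⟩
  have hmem : ∀ i (s : Finset lam), s.Nonempty → (∀ l ∈ s, i ∈ g {l}) → i ∈ g s := by
    intro i s hs
    induction hs using Finset.Nonempty.cons_induction with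
    | singleton l => exact fun h => h l (Finset.mem_singleton_self l)
    | cons l s hl hs ih =>
      intro h
      have h1 : i ∈ g ({l} ∪ s) := by
        have h2 := hg {l} s
        have h3 : i ∈ g {l} ∩ g s :=
          ⟨h l (Finset.mem_cons_self l s), ih fun k hk => h k (Finset.mem_cons_of_mem hk)⟩
        rw [← h2] at h3
        convert h3
      rwa [Finset.cons_eq_insert, Finset.insert_eq]
  have hfin : ∀ i, {l | i ∈ g {l}}.Finite := by
    intro i
    by_contra hinf
    have h : i ∈ ⋂ n, J n := Set.mem_iInter.2 fun n => by
      obtain ⟨s, hs, hcard⟩ := Set.Infinite.exists_subset_card_eq hinf (n + 1)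
      have h1 := hgf s (hmem i s (Finset.card_pos.1 (by omega)) fun l hl => hs hl)
      exact hJ (by omega) h1.1
    rw [hJempty] at h
    exact h
  have hx : ∀ i, ∃ x : X i, ∀ l, i ∈ g {l} → P l i x := by
    intro i
    rcases (hfin i).toFinset.eq_empty_or_nonempty with h | h
    · refine ⟨Classical.arbitrary _, fun l hl => ?_⟩
      have h1 : l ∈ (hfin i).toFinset := (hfin i).mem_toFinset.2 hl
      rw [h] at h1
      exact absurd h1 (Finset.notMem_empty l)
    · obtain ⟨x, hx⟩ := (hgf _ (hmem i _ h fun l hl => (hfin i).mem_toFinset.1 hl)).2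
      exact ⟨x, fun l hl => hx l ((hfin i).mem_toFinset.2 hl)⟩
  choose x hx using hx
  exact ⟨x, fun l => Filter.mem_of_superset (hgF {l}) fun i hi => hx i l hi⟩

end Good

/-! ### Saturation of ultraproducts -/

/-- A functional that is finitely approximable in an ultraproduct along a good ultrafilter agrees on
all formulas with rational coefficients with the evaluation functional of some tuple. -/
theorem exists_eval_decode_eq {κ : Cardinal.{u}} {I : Type u} {F : Ultrafilter I}
    (hF : IsCountablyIncomplete F) (hgood : IsGood F κ) (hκ : L.toLanguage.card + ℵ₀ < κ)
    (M : I → MetricStructure L) {A : Set (ultraproduct F M)} (hA : #A < κ) {n : ℕ}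
    {p : ParamFormula (ultraproduct F M) A n → ℝ}
    (hp : ∀ (J : Finset (ParamFormula (ultraproduct F M) A n)) (ε : ℝ), 0 < ε →
      ∃ b : Fin n → ultraproduct F M, ∀ φ ∈ J,
        |eval (ultraproduct F M) (Sum.elim (fun a : A => (a : ultraproduct F M)) b) φ - p φ| < ε) :
    ∃ b : Fin n → ultraproduct F M, ∀ w : Code L (A ⊕ Fin n),
      eval (ultraproduct F M) (Sum.elim (fun a : A => (a : ultraproduct F M)) b) (w.decode 0) =
        p (w.decode 0) := by
  classical
  have hκ₀ : ℵ₀ < κ := (self_le_add_left _ _).trans_lt hκ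
  have hcode : #(Code L (A ⊕ Fin n)) < κ := by
    refine mk_code_lt L _ ((self_le_add_right _ _).trans_lt hκ) ?_ hκ₀
    rw [mk_sum, lift_uzero]
    refine add_lt_of_lt hκ₀.le hA ?_
    exact (Cardinal.lift_le_aleph0.2 mk_le_aleph0).trans_lt hκ₀
  -- evaluation in the `i`-th factor, with the parameters replaced by their `i`-th coordinates
  let val : ∀ i, (Fin n → M i) → Code L (A ⊕ Fin n) → ℝ := fun i b w =>
    eval (M i) (Sum.elim (fun a : A => ultraOut F M (a : ultraproduct F M) i) b) (w.decode 0)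
  have hval : ∀ (x : ∀ i, Fin n → M i) (w : Code L (A ⊕ Fin n)),
      Tendsto (fun i => val i (x i) w) F (𝓝 (eval (ultraproduct F M)
        (Sum.elim (fun a : A => (a : ultraproduct F M)) fun k => ultraMk F M fun i => x i k)
        (w.decode 0))) := by
    intro x w
    have h := tendsto_eval F M (Sum.elim (fun a : A => ultraOut F M (a : ultraproduct F M))
      fun k i => x i k) (w.decode 0)
    have h1 : (fun a => ultraMk F M ((Sum.elim (fun a : A => ultraOut F M (a : ultraproduct F M))
        fun k i => x i k : A ⊕ Fin n → ∀ i, M i) a)) =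
        Sum.elim (fun a : A => (a : ultraproduct F M)) fun k => ultraMk F M fun i => x i k := by
      funext a
      rcases a with a | k
      · exact ultraMk_out F M a.1
      · rfl
    rw [h1] at h
    refine h.congr fun i => ?_
    change _ = eval _ _ _
    congr 1
    funext a
    cases a <;> rfl
  obtain ⟨x, hx⟩ := exists_forall_eventually_of_isGood hF hgood (lam := Code L (A ⊕ Fin n) × ℕ)
    (aleph0_le_mk _)
    (by
      rw [mk_prod, lift_uzero, mk_nat, lift_aleph0]
      exact mul_lt_of_lt hκ₀.le hcode hκ₀)
    (X := fun i => Fin n → M i)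
    (fun l i b => |val i b l.1 - p (l.1.decode 0)| < 1 / ((l.2 : ℝ) + 1)) fun s => by
      obtain ⟨b, hb⟩ := hp (s.image fun l => l.1.decode 0)
        (1 / ((s.sup fun l => l.2 : ℕ) + 1 : ℝ)) (by positivity)
      have h1 : ∀ᶠ i in (F : Filter I), ∀ l ∈ s,
          |val i (fun k => ultraOut F M (b k) i) l.1 - p (l.1.decode 0)| <
            1 / ((l.2 : ℝ) + 1) := by
        rw [Filter.eventually_all_finset]
        intro l hl
        refine Tendsto.eventually_lt_const ?_
          ((hval (fun i k => ultraOut F M (b k) i) l.1).sub_const _).abs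
        have h2 := hb _ (Finset.mem_image_of_mem (fun l => l.1.decode 0) hl)
        have h4 : (fun k => ultraMk F M fun i => ultraOut F M (b k) i) = b :=
          funext fun k => ultraMk_out F M (b k)
        rw [h4]
        refine h2.trans_le (one_div_le_one_div_of_le (by positivity) ?_)
        have h3 : l.2 ≤ s.sup fun l => l.2 := Finset.le_sup (f := fun l => l.2) hl
        exact add_le_add (Nat.cast_le.2 h3) le_rfl
      exact h1.mono fun i hi => ⟨_, hi⟩
  refine ⟨fun k => ultraMk F M fun i => x i k, fun w => ?_⟩
  have h : ∀ k : ℕ, |eval (ultraproduct F M) (Sum.elim (fun a : A => (a : ultraproduct F M))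
      fun k => ultraMk F M fun i => x i k) (w.decode 0) - p (w.decode 0)| ≤
        1 / ((k : ℝ) + 1) := fun k =>
    le_of_tendsto ((hval x w).sub_const _).abs ((hx (w, k)).mono fun i hi => hi.le)
  have h1 := ge_of_tendsto' tendsto_one_div_add_atTop_nhds_zero_nat h
  exact sub_eq_zero.1 (abs_eq_zero.1 (le_antisymm h1 (abs_nonneg _)))

end AffineLogic

open AffineLogic Cardinal in
theorem mainTheorem6 (L : LipschitzLanguage.{u}) (κ : Cardinal.{u}) (I : Type u)
    (F : Ultrafilter I) (hF : IsCountablyIncomplete F) (hgood : IsGood F κ)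
    (hκ : L.toLanguage.card + ℵ₀ < κ) (M : I → MetricStructure L) :
    IsExtremallySaturated (ultraproduct F M) κ := by
  intro A hA n p hp
  obtain ⟨b, hb⟩ := exists_eval_decode_eq hF hgood hκ M hA fun J ε hε =>
    exists_approx_of_mem_extremePoints (ultraproduct F M) A n hp J hε
  obtain ⟨N, c, d, -, hd⟩ := (mem_typeSpace_iff _ _ _).1 hp.1
  refine ⟨b, fun φ => ?_⟩
  -- `p` is itself an evaluation functional, so both sides are determined on the dense family
  refine eq_of_abs_sub_le_all fun ε hε => ?_
  obtain ⟨w, hw⟩ := exists_code_approx φ (half_pos hε)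
  have h1 := abs_le.1 (hw (ultraproduct F M) (Sum.elim (fun a : A => (a : ultraproduct F M)) b)
    Fin.elim0)
  have h2 := abs_le.1 (hw N (Sum.elim c d) Fin.elim0)
  have h3 := hb w
  rw [← hd (w.decode 0)] at h3
  rw [← hd φ]
  unfold eval at h3 ⊢
  exact abs_le.2 ⟨by linarith, by linarith⟩
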